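/- Let $I=(-1,1)$, let $\beta>0$ and $y_d\in L_2(I)$, and let $f,\psi$ satisfy $f\in H^{\frac12-\epsilon}(I)$ and $\psi\in H^{\frac32-\epsilon}(I)$ for every $\epsilon\in(0,\frac12)$, and $\int_I\psi\,dx>0$. Put $V=\{v\in H^2(I): v(-1)=v(1)=0\}$ and $K=\{y\in V: y'\le\psi \text{ on } I\}$. Let $\bar y$ be the optimal state of the problem of minimizing $\frac12\big[\|y-y_d\|_{L_2(I)}^2+\beta\|u\|_{L_2(I)}^2\big]$ over all $y\in K$ and $u\in L_2(I)$ with $-y''=u+f$ on $I$, that is, the solution $\bar y\in K$ of the variational inequality $$\int_I(\bar y-y_d)(y-\bar y)\,dx+\beta\int_I(\bar y''+f)(y''-\bar y'')\,dx\ge 0\qquad\text{for all } y\in K .$$ Then $\bar y\in H^{\frac52-\epsilon}(I)$ for every $\epsilon\in(0,\frac12)$. Here, for $s\ge 0$, $H^s(I)$ is the (Sobolev--Slobodeckij) space of all $v\in L_2(I)$ whose weak derivatives of order at most $m=\lfloor s\rfloor$ lie in $L_2(I)$ and for which, if $\sigma=s-m>0$, $\int_I\int_I |v^{(m)}(x)-v^{(m)}(t)|^2\,|x-t|^{-1-2\sigma}\,dx\,dt<\infty$.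 -/

import Mathlib

noncomputable section

open MeasureTheory Set
open scoped ContDiff ENNReal

namespace DerivativeConstrained

/-- The open interval `I = (-1, 1)`. -/
abbrev unitI : Set ℝ := Ioo (-1) 1

/-- Membership in `L₂(I)`; only the values on `I` matter. -/
def MemL2 (v : ℝ → ℝ) : Prop := MemLp v 2 (volume.restrict unitI)

/-- `g` is a weak (distributional) derivative of order `k` of `v` on `I`, tested against
smooth functions with compact support in `I`. -/
structure HasWeakDeriv (k : ℕ) (v g : ℝ → ℝ) : Prop where
  locallyIntegrable : LocallyIntegrableOn v unitI
  locallyIntegrable_deriv : LocallyIntegrableOn g unitI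
  integral_eq : ∀ φ : ℝ → ℝ, ContDiff ℝ ∞ φ → HasCompactSupport φ → tsupport φ ⊆ unitI →
    ∫ x in unitI, v x * iteratedDeriv k φ x = (-1) ^ k * ∫ x in unitI, g x * φ x

/-- Weak derivatives are unique up to equality almost everywhere on `I`. -/
theorem HasWeakDeriv.ae_unique {k : ℕ} {v g h : ℝ → ℝ} (hg : HasWeakDeriv k v g)
    (hh : HasWeakDeriv k v h) : g =ᵐ[volume.restrict unitI] h := by
  have hint : ∀ w : ℝ → ℝ, LocallyIntegrableOn w unitI → ∀ φ : ℝ → ℝ, Continuous φ →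
      HasCompactSupport φ → tsupport φ ⊆ unitI →
      IntegrableOn (fun x => w x * φ x) unitI := by
    intro w hw φ hφ hc hs
    have h1 : IntegrableOn w (tsupport φ) := hw.integrableOn_compact_subset hs hc
    have h2 : IntegrableOn (fun x => w x * φ x) (tsupport φ) :=
      h1.mul_continuousOn hφ.continuousOn hc
    have h3 : Function.support (fun x => w x * φ x) ⊆ tsupport φ := fun x hx =>
      subset_tsupport φ (fun h0 => hx (by simp [h0]))
    exact ((integrableOn_iff_integrable_of_support_subset h3).1 h2).integrableOn
  have key : ∀ᵐ x ∂volume, x ∈ unitI → (g x - h x) = 0 := by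
    refine isOpen_Ioo.ae_eq_zero_of_integral_contDiff_smul_eq_zero
      (f := fun x => g x - h x)
      (hg.locallyIntegrable_deriv.sub hh.locallyIntegrable_deriv) ?_
    intro φ hφ hc hs
    have e := (hg.integral_eq φ hφ hc hs).symm.trans (hh.integral_eq φ hφ hc hs)
    have e' := mul_left_cancel₀ (pow_ne_zero k (by norm_num : (-1 : ℝ) ≠ 0)) e
    have h4 : ∫ x in unitI, (g x * φ x - h x * φ x) = 0 := by
      rw [integral_sub (hint g hg.locallyIntegrable_deriv φ hφ.continuous hc hs)
        (hint h hh.locallyIntegrable_deriv φ hφ.continuous hc hs), e', sub_self]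
    have h5 : ∫ x, (g x * φ x - h x * φ x) = 0 := by
      rw [← h4]
      symm
      apply setIntegral_eq_integral_of_forall_compl_eq_zero
      intro x hx
      have : φ x = 0 := by
        by_contra h0
        exact hx (hs (subset_tsupport φ h0))
      simp [this]
    rw [← h5]
    congr 1
    ext x
    simp only [smul_eq_mul]
    ring
  refine (ae_restrict_iff' measurableSet_Ioo).2 ?_
  filter_upwards [key] with x hx hxI
  exact sub_eq_zero.1 (hx hxI)

open Classical in
/-- The weak derivative of order `k` on `I` (a representative of it), and `0` if there is none. -/
def weakDeriv (k : ℕ) (v : ℝ → ℝ) : ℝ → ℝ :=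
  if h : ∃ g, HasWeakDeriv k v g then h.choose else 0

/-- If `v` has a weak derivative of order `k`, then `weakDeriv k v` is one. -/
theorem HasWeakDeriv.weakDeriv {k : ℕ} {v g : ℝ → ℝ} (hg : HasWeakDeriv k v g) :
    HasWeakDeriv k v (weakDeriv k v) := by
  have h : ∃ g, HasWeakDeriv k v g := ⟨g, hg⟩
  rw [DerivativeConstrained.weakDeriv, dif_pos h]
  exact h.choose_spec

/-- The square of the Gagliardo (Sobolev-Slobodeckij) seminorm of order `σ ∈ (0, 1)` on `I`,
`∫_I ∫_I |g x - g y|² / |x - y|^(1 + 2 σ) dy dx`. -/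
def gagliardoSq (σ : ℝ) (g : ℝ → ℝ) : ℝ≥0∞ :=
  ∫⁻ x in unitI, ∫⁻ y in unitI, ENNReal.ofReal ((g x - g y) ^ 2 / |x - y| ^ (1 + 2 * σ))

/-- Membership in the Sobolev space `H^s(I) = W^{s,2}(I)` for real `s ≥ 0`: the weak derivatives
of order at most `⌊s⌋` exist and lie in `L₂(I)` and, if `s` is not an integer, the derivative of
order `⌊s⌋` has a finite Gagliardo seminorm of order `s - ⌊s⌋`. -/
structure MemH (s : ℝ) (v : ℝ → ℝ) : Prop where
  nonneg : 0 ≤ s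
  hasWeakDeriv : ∀ k ≤ ⌊s⌋₊, HasWeakDeriv k v (weakDeriv k v)
  memL2 : ∀ k ≤ ⌊s⌋₊, MemL2 (weakDeriv k v)
  gagliardo : Int.fract s ≠ 0 → gagliardoSq (Int.fract s) (weakDeriv ⌊s⌋₊ v) < ⊤

/-- The space `V = {v ∈ H²(I) : v(-1) = v(1) = 0}`. Elements of `H²(I)` are represented by
functions that are continuous on `[-1, 1]`, so that the boundary values make sense. -/
structure MemV (v : ℝ → ℝ) : Prop where
  memH : MemH 2 v
  continuousOn : ContinuousOn v (Icc (-1) 1)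
  left : v (-1) = 0
  right : v 1 = 0

/-- The constraint set `K = {y ∈ V : y' ≤ ψ on I}`. -/
structure MemK (ψ y : ℝ → ℝ) : Prop where
  memV : MemV y
  deriv_le : ∀ᵐ x ∂(volume.restrict unitI), weakDeriv 1 y x ≤ ψ x

/-- `ybar` solves the variational inequality of the optimal control problem: `ybar ∈ K` and
`∫_I (ybar - y_d) (y - ybar) + β ∫_I (ybar'' + f) (y'' - ybar'') ≥ 0` for all `y ∈ K`. -/
structure IsSolution (β : ℝ) (yd f ψ ybar : ℝ → ℝ) : Prop where
  memK : MemK ψ ybar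
  ineq : ∀ y : ℝ → ℝ, MemK ψ y →
    0 ≤ (∫ x in unitI, (ybar x - yd x) * (y x - ybar x)) +
      β * ∫ x in unitI, (weakDeriv 2 ybar x + f x) * (weakDeriv 2 y x - weakDeriv 2 ybar x)

end DerivativeConstrained

end

noncomputable section
open MeasureTheory Set
open scoped ContDiff ENNReal
namespace DerivativeConstrained

/-! Write F = β(ȳ'' + f). In terms of z = (y - ȳ)' the variational inequality reads ∫ (ȳ - y_d) ∫₋₁ˣ
z + ∫ F z' ≥ 0 for all z ∈ H¹(I) of mean zero with z ≤ ψ - ȳ' (`IsSolution.costDeriv_nonneg`). Since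
ȳ' has mean zero and ψ has positive mean, ψ - ȳ' is an admissible direction of positive mean, and
the constant -1 is one of negative mean. Hence the mean value constraint can be traded for a
multiplier (`exists_multiplier`). The multiplier term and the first integral are both controlled by
‖z‖₁, so ∫ F z' ≥ -M ‖z‖₁ for every z ≤ 0 in H¹(I) (`exists_bound_of_costDeriv_nonneg`). Formally
this says F' + M ≥ 0. Testing with differences of steep ramps turns it into a comparison of averages
of F, and Lebesgue differentiation shows that F(x) + M x is a.e. a monotone function G
(`exists_monotone_of_bound`). A monotone function lies in H^σ(I) for all σ < 1/2, because its L¹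
modulus of continuity is linear (`Monotone.gagliardoSq_lt_top`). Therefore ȳ'' = β⁻¹(G - M x) - f
inherits the regularity H^(1/2-ε) from G and f. -/

/-! ### Calculus of weak derivatives on I. -/

theorem integrableOn_mul_test {w φ : ℝ → ℝ} (hw : LocallyIntegrableOn w unitI)
    (hφ : Continuous φ) (hc : HasCompactSupport φ) (hs : tsupport φ ⊆ unitI) :
    IntegrableOn (fun x => w x * φ x) unitI := by
  have h1 : IntegrableOn w (tsupport φ) := hw.integrableOn_compact_subset hs hc
  have h2 : IntegrableOn (fun x => w x * φ x) (tsupport φ) :=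
    h1.mul_continuousOn hφ.continuousOn hc
  have h3 : Function.support (fun x => w x * φ x) ⊆ tsupport φ := fun x hx =>
    subset_tsupport φ (fun h0 => hx (by simp [h0]))
  exact ((integrableOn_iff_integrable_of_support_subset h3).1 h2).integrableOn

theorem contDiff_deriv_test {φ : ℝ → ℝ} (hφ : ContDiff ℝ ∞ φ) : ContDiff ℝ ∞ (deriv φ) :=
  ((contDiff_infty_iff_deriv).1 hφ).2

theorem contDiff_iteratedDeriv_test (k : ℕ) {φ : ℝ → ℝ} (hφ : ContDiff ℝ ∞ φ) :
    ContDiff ℝ ∞ (iteratedDeriv k φ) := by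
  induction k with
  | zero => simpa using hφ
  | succ n ih => rw [iteratedDeriv_succ]; exact contDiff_deriv_test ih

theorem tsupport_iteratedDeriv_subset (k : ℕ) (φ : ℝ → ℝ) :
    tsupport (iteratedDeriv k φ) ⊆ tsupport φ := by
  induction k with
  | zero => simp
  | succ n ih =>
    rw [iteratedDeriv_succ]
    exact (closure_minimal support_deriv_subset isClosed_closure).trans ih

theorem HasWeakDeriv.add {k : ℕ} {v g w h : ℝ → ℝ} (hv : HasWeakDeriv k v g)
    (hw : HasWeakDeriv k w h) : HasWeakDeriv k (v + w) (g + h) where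
  locallyIntegrable := hv.locallyIntegrable.add hw.locallyIntegrable
  locallyIntegrable_deriv := hv.locallyIntegrable_deriv.add hw.locallyIntegrable_deriv
  integral_eq φ hφ hc hs := by
    have hcd := (contDiff_iteratedDeriv_test k hφ).continuous
    have hcc : HasCompactSupport (iteratedDeriv k φ) :=
      hc.of_isClosed_subset isClosed_closure (tsupport_iteratedDeriv_subset k φ)
    have hss := (tsupport_iteratedDeriv_subset k φ).trans hs
    simp only [Pi.add_apply, add_mul]
    rw [integral_add (integrableOn_mul_test hv.locallyIntegrable hcd hcc hss)
      (integrableOn_mul_test hw.locallyIntegrable hcd hcc hss),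
      integral_add (integrableOn_mul_test hv.locallyIntegrable_deriv hφ.continuous hc hs)
      (integrableOn_mul_test hw.locallyIntegrable_deriv hφ.continuous hc hs),
      hv.integral_eq φ hφ hc hs, hw.integral_eq φ hφ hc hs, mul_add]

theorem HasWeakDeriv.const_smul {k : ℕ} {v g : ℝ → ℝ} (hv : HasWeakDeriv k v g) (c : ℝ) :
    HasWeakDeriv k (c • v) (c • g) where
  locallyIntegrable := hv.locallyIntegrable.smul c
  locallyIntegrable_deriv := hv.locallyIntegrable_deriv.smul c
  integral_eq φ hφ hc hs := by
    simp only [Pi.smul_apply, smul_eq_mul, mul_assoc, integral_const_mul,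
      hv.integral_eq φ hφ hc hs]
    ring

theorem HasWeakDeriv.zero_order {v : ℝ → ℝ} (hv : LocallyIntegrableOn v unitI) :
    HasWeakDeriv 0 v v :=
  ⟨hv, hv, fun φ _ _ _ => by simp⟩

theorem HasWeakDeriv.weakDeriv_ae {k : ℕ} {v g : ℝ → ℝ} (hv : HasWeakDeriv k v g) :
    DerivativeConstrained.weakDeriv k v =ᵐ[volume.restrict unitI] g :=
  hv.weakDeriv.ae_unique hv

theorem HasWeakDeriv.succ_of_one {k : ℕ} {v g r : ℝ → ℝ} (hv : HasWeakDeriv 1 v g)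
    (hg : HasWeakDeriv k g r) : HasWeakDeriv (k + 1) v r where
  locallyIntegrable := hv.locallyIntegrable
  locallyIntegrable_deriv := hg.locallyIntegrable_deriv
  integral_eq φ hφ hc hs := by
    have hcc : HasCompactSupport (iteratedDeriv k φ) :=
      hc.of_isClosed_subset isClosed_closure (tsupport_iteratedDeriv_subset k φ)
    have := hv.integral_eq _ (contDiff_iteratedDeriv_test k hφ) hcc
      ((tsupport_iteratedDeriv_subset k φ).trans hs)
    rw [iteratedDeriv_one, ← iteratedDeriv_succ, hg.integral_eq φ hφ hc hs] at this
    rw [this]; ring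

/-- Test the first derivative with φ⁽ᵏ⁾. Since `MemH` lists the derivatives of v separately, this is
what makes ȳ' an H¹ function with derivative ȳ''. -/
theorem HasWeakDeriv.one_of_succ {k : ℕ} {v g r : ℝ → ℝ} (hv : HasWeakDeriv 1 v g)
    (hr : HasWeakDeriv (k + 1) v r) : HasWeakDeriv k g r where
  locallyIntegrable := hv.locallyIntegrable_deriv
  locallyIntegrable_deriv := hr.locallyIntegrable_deriv
  integral_eq φ hφ hc hs := by
    have hcc : HasCompactSupport (iteratedDeriv k φ) :=
      hc.of_isClosed_subset isClosed_closure (tsupport_iteratedDeriv_subset k φ)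
    have := hv.integral_eq _ (contDiff_iteratedDeriv_test k hφ) hcc
      ((tsupport_iteratedDeriv_subset k φ).trans hs)
    rw [iteratedDeriv_one, ← iteratedDeriv_succ, hr.integral_eq φ hφ hc hs, pow_succ] at this
    linarith

theorem setIntegral_unitI (v : ℝ → ℝ) : ∫ x in unitI, v x = ∫ x in (-1 : ℝ)..1, v x := by
  rw [intervalIntegral.integral_of_le (by norm_num), integral_Ioc_eq_integral_Ioo]

theorem intervalIntegrable_iff_unitI {v : ℝ → ℝ} :
    IntervalIntegrable v volume (-1) 1 ↔ IntegrableOn v unitI := by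
  rw [intervalIntegrable_iff_integrableOn_Ioo_of_le (by norm_num)]

theorem continuousOn_primitive_unitI {k : ℝ → ℝ} (hk : IntegrableOn k unitI) :
    ContinuousOn (fun x => ∫ t in (-1 : ℝ)..x, k t) (Icc (-1) 1) := by
  have := intervalIntegral.continuousOn_primitive_interval (a := (-1 : ℝ)) (b := 1) (μ := volume)
    (f := k) (by rw [uIcc_of_le (by norm_num), integrableOn_Icc_iff_integrableOn_Ioo]; exact hk)
  rwa [uIcc_of_le (by norm_num)] at this

theorem test_eq_zero_of_notMem {φ : ℝ → ℝ} (hs : tsupport φ ⊆ unitI) {x : ℝ} (hx : x ∉ unitI) :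
    φ x = 0 := by
  by_contra h0
  exact hx (hs (subset_tsupport φ h0))

/-- The primitive of an integrable function has that function as its weak derivative. -/
theorem hasWeakDeriv_primitive {k : ℝ → ℝ} (hk : IntegrableOn k unitI) (c : ℝ) :
    HasWeakDeriv 1 (fun x => c + ∫ t in (-1 : ℝ)..x, k t) k where
  locallyIntegrable := ((continuousOn_const.add (continuousOn_primitive_unitI hk)).mono
    Ioo_subset_Icc_self).locallyIntegrableOn measurableSet_Ioo
  locallyIntegrable_deriv := hk.locallyIntegrableOn
  integral_eq φ hφ hc hs := by
    have hk' := intervalIntegrable_iff_unitI.2 hk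
    have hac : AbsolutelyContinuousOnInterval (fun x => ∫ t in (-1 : ℝ)..x, k t) (-1) 1 :=
      hk'.absolutelyContinuousOnInterval_intervalIntegral (by simp)
    have hφac : AbsolutelyContinuousOnInterval φ (-1) 1 := by
      obtain ⟨C, hC⟩ := (hφ.of_le (by simp) : ContDiff ℝ 1 φ).lipschitzWith_of_hasCompactSupport
        hc (by simp)
      exact (hC.lipschitzOnWith (s := uIcc (-1) 1)).absolutelyContinuousOnInterval
    have e := hac.integral_mul_deriv_eq_deriv_mul hφac
    have h1 : φ 1 = 0 := test_eq_zero_of_notMem hs (by simp)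
    have h2 : φ (-1) = 0 := test_eq_zero_of_notMem hs (by simp)
    have hd : Continuous (deriv φ) := (contDiff_deriv_test hφ).continuous
    have hc0 : ∫ x in (-1 : ℝ)..1, deriv φ x = 0 := by
      rw [intervalIntegral.integral_deriv_eq_sub (fun x _ => hφ.differentiable (by simp) x)
        (hd.intervalIntegrable _ _), h1, h2, sub_zero]
    have e2 : ∫ x in (-1 : ℝ)..1, deriv (fun x => ∫ t in (-1 : ℝ)..x, k t) x * φ x
        = ∫ x in (-1 : ℝ)..1, k x * φ x := by
      apply intervalIntegral.integral_congr_ae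
      filter_upwards [hk'.ae_hasDerivAt_integral] with x hx hxm
      rw [(hx (uIoc_subset_uIcc hxm) (-1) (by simp)).deriv]
    rw [setIntegral_unitI, setIntegral_unitI]
    simp only [iteratedDeriv_one, add_mul]
    rw [intervalIntegral.integral_add, intervalIntegral.integral_const_mul, hc0, e, e2, h1, h2]
    · ring
    · exact (hd.intervalIntegrable _ _).const_mul c
    · refine ContinuousOn.intervalIntegrable ?_
      rw [uIcc_of_le (by norm_num)]
      exact (continuousOn_primitive_unitI hk).mul hd.continuousOn

/-- **Du Bois-Reymond lemma**: a function with vanishing weak derivative is constant. -/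
theorem HasWeakDeriv.ae_eq_const {v : ℝ → ℝ} (hv : HasWeakDeriv 1 v 0) :
    ∃ c : ℝ, v =ᵐ[volume.restrict unitI] fun _ => c := by
  let b : ContDiffBump (0 : ℝ) := ⟨1 / 4, 1 / 2, by norm_num, by norm_num⟩
  have hbs : tsupport (b.normed volume) ⊆ unitI := by
    rw [b.tsupport_normed_eq]
    intro x hx
    rw [Metric.mem_closedBall, Real.dist_eq, sub_zero, abs_le] at hx
    have hr : b.rOut = 1 / 2 := rfl
    rw [hr] at hx
    constructor <;> linarith [hx.1, hx.2]
  have hbI : ∫ x, b.normed volume x = 1 := b.integral_normed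
  have hbc : ContDiff ℝ ∞ (b.normed volume) := b.contDiff_normed
  have hbk : HasCompactSupport (b.normed volume) := b.hasCompactSupport_normed
  set η := b.normed volume
  refine ⟨∫ x in unitI, v x * η x, ?_⟩
  set c := ∫ x in unitI, v x * η x
  have key : ∀ᵐ x ∂volume, x ∈ unitI → (v x - c) = 0 := by
    refine isOpen_Ioo.ae_eq_zero_of_integral_contDiff_smul_eq_zero
      (f := fun x => v x - c) (hv.locallyIntegrable.sub
        (continuousOn_const.locallyIntegrableOn measurableSet_Ioo)) ?_
    intro φ hφ hc hs
    set m := ∫ x, φ x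
    have hφi : Integrable φ := hφ.continuous.integrable_of_hasCompactSupport hc
    have hηi : Integrable η := hbc.continuous.integrable_of_hasCompactSupport hbk
    -- Subtracting m η, where η is a bump of mass one, removes the mass of φ. The primitive Θ then
    -- has compact support in I and is a legitimate test function with Θ' = θ.
    let θ : ℝ → ℝ := fun x => φ x - m * η x
    have hθc : ContDiff ℝ ∞ θ := hφ.sub (contDiff_const.mul hbc)
    have hθi : ∀ a b, IntervalIntegrable θ volume a b :=
      fun a b => hθc.continuous.intervalIntegrable a b
    let Θ : ℝ → ℝ := fun x => ∫ t in (-1 : ℝ)..x, θ t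
    have hΘd : ∀ x, HasDerivAt Θ (θ x) x := fun x =>
      intervalIntegral.integral_hasDerivAt_right (hθi _ _)
        hθc.continuous.stronglyMeasurable.stronglyMeasurableAtFilter hθc.continuous.continuousAt
    have hΘ' : deriv Θ = θ := funext fun x => (hΘd x).deriv
    have hΘc : ContDiff ℝ ∞ Θ := contDiff_infty_iff_deriv.2
      ⟨fun x => (hΘd x).differentiableAt, hΘ' ▸ hθc⟩
    have hK : IsCompact (tsupport φ ∪ tsupport η) := hc.isCompact.union hbk.isCompact
    obtain ⟨r, hr1, hrI⟩ : ∃ r : ℝ, r < 1 ∧ tsupport φ ∪ tsupport η ⊆ Icc (-r) r := by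
      obtain ⟨x0, hx0, hmax⟩ := hK.exists_isMaxOn
        (by
          by_contra hne
          rw [not_nonempty_iff_eq_empty, union_empty_iff, tsupport_eq_empty_iff] at hne
          have : η = 0 := tsupport_eq_empty_iff.1 hne.2
          simp [this] at hbI) (continuous_abs.continuousOn)
      refine ⟨|x0|, ?_, fun x hx => ?_⟩
      · have := union_subset hs hbs hx0
        exact abs_lt.2 this
      · exact abs_le.1 (hmax hx)
    have hθ0 : ∀ x, x ∉ Icc (-r) r → θ x = 0 := by
      intro x hx
      have h1 : φ x = 0 := by
        by_contra h0; exact hx (hrI (Or.inl (subset_tsupport φ h0)))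
      have h2 : η x = 0 := by
        by_contra h0; exact hx (hrI (Or.inr (subset_tsupport η h0)))
      simp [θ, h1, h2]
    have hθI : ∫ x, θ x = 0 := by
      rw [integral_sub hφi (hηi.const_mul m), integral_const_mul, hbI, mul_one, sub_self]
    have hθ11 : ∫ x in (-1 : ℝ)..1, θ x = 0 := by
      rw [← setIntegral_unitI, ← hθI]
      apply setIntegral_eq_integral_of_forall_compl_eq_zero
      intro x hx
      exact hθ0 x fun h => hx ⟨by linarith [h.1], by linarith [h.2]⟩
    have hΘ0 : ∀ x, x ∉ Icc (-r) r → Θ x = 0 := by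
      intro x hx
      rw [mem_Icc, not_and_or, not_le, not_le] at hx
      rcases hx with hx | hx
      · refine intervalIntegral.integral_zero_ae (Filter.Eventually.of_forall fun t ht => hθ0 t ?_)
        rw [mem_uIoc] at ht
        rintro ⟨h1, h2⟩
        rcases ht with ht | ht <;> linarith [ht.1, ht.2]
      -- To the right of the support, Θ equals the total mass of θ, which is zero.
      · have : Θ x = (∫ t in (-1 : ℝ)..1, θ t) + ∫ t in (1 : ℝ)..x, θ t :=
          (intervalIntegral.integral_add_adjacent_intervals (hθi _ _) (hθi _ _)).symm
        rw [this, hθ11, zero_add]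
        refine intervalIntegral.integral_zero_ae (Filter.Eventually.of_forall fun t ht => hθ0 t ?_)
        rw [mem_uIoc] at ht
        rintro ⟨h1, h2⟩
        rcases ht with ht | ht <;> linarith [ht.1, ht.2]
    have hΘs : tsupport Θ ⊆ Icc (-r) r :=
      closure_minimal (fun x hx => by by_contra h; exact hx (hΘ0 x h)) isClosed_Icc
    have e := hv.integral_eq Θ hΘc (isCompact_Icc.of_isClosed_subset isClosed_closure hΘs)
      (hΘs.trans (Icc_subset_Ioo (by linarith) hr1))
    rw [iteratedDeriv_one, hΘ'] at e
    have hi1 := integrableOn_mul_test hv.locallyIntegrable hφ.continuous hc hs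
    have hi2 := integrableOn_mul_test hv.locallyIntegrable hbc.continuous hbk hbs
    have e2 : (∫ x in unitI, v x * φ x) - m * c = 0 := by
      rw [← integral_const_mul, ← integral_sub hi1 (hi2.const_mul m)]
      simpa [θ, mul_sub, mul_left_comm] using e
    have e3 : ∫ x in unitI, φ x = m :=
      setIntegral_eq_integral_of_forall_compl_eq_zero fun x hx => test_eq_zero_of_notMem hs hx
    calc ∫ x, φ x • (v x - c) = ∫ x in unitI, (v x * φ x - c * φ x) := by
          rw [← setIntegral_eq_integral_of_forall_compl_eq_zero (s := unitI)
            (fun x hx => by rw [test_eq_zero_of_notMem hs hx, zero_smul])]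
          congr 1; ext x; simp only [smul_eq_mul]; ring
      _ = 0 := by
          rw [integral_sub hi1 (hφi.integrableOn.const_mul c), integral_const_mul, e3]
          linarith
  refine (ae_restrict_iff' measurableSet_Ioo).2 ?_
  filter_upwards [key] with x hx hxI
  exact sub_eq_zero.1 (hx hxI)

/-! ### Primitives, boundary values and H¹(I). -/

theorem MemL2.integrableOn {v : ℝ → ℝ} (hv : MemL2 v) : IntegrableOn v unitI :=
  MemLp.integrable (by norm_num) hv

/-- A function with an integrable weak derivative is a.e. a primitive of it. -/
theorem HasWeakDeriv.ae_eq_primitive {v g : ℝ → ℝ} (hv : HasWeakDeriv 1 v g)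
    (hg : IntegrableOn g unitI) :
    ∃ c : ℝ, v =ᵐ[volume.restrict unitI] fun x => c + ∫ t in (-1 : ℝ)..x, g t := by
  have h := hv.add ((hasWeakDeriv_primitive hg 0).const_smul (-1))
  rw [show g + (-1 : ℝ) • g = 0 by ext; simp] at h
  obtain ⟨c, hc⟩ := h.ae_eq_const
  refine ⟨c, ?_⟩
  filter_upwards [hc] with x hx
  simp at hx
  linarith

/-- The weak derivative of an element of `V` has mean value zero. -/
theorem setIntegral_weakDeriv_eq_zero {v g : ℝ → ℝ} (hv : HasWeakDeriv 1 v g)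
    (hg : IntegrableOn g unitI) (hc : ContinuousOn v (Icc (-1) 1)) (h1 : v (-1) = 0)
    (h2 : v 1 = 0) : ∫ x in unitI, g x = 0 := by
  obtain ⟨c, hvc⟩ := hv.ae_eq_primitive hg
  -- Both sides are continuous on the closed interval, so a.e. equality extends to the endpoints,
  -- where the boundary conditions live.
  have heq : EqOn v (fun x => c + ∫ t in (-1 : ℝ)..x, g t) (Icc (-1) 1) := by
    refine Measure.eqOn_Icc_of_ae_eq volume (by norm_num) ?_ hc
      (continuousOn_const.add (continuousOn_primitive_unitI hg))
    rw [← restrict_Ioo_eq_restrict_Icc]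
    exact hvc
  have e1 := heq (left_mem_Icc.2 (by norm_num : (-1 : ℝ) ≤ 1))
  have e2 := heq (right_mem_Icc.2 (by norm_num : (-1 : ℝ) ≤ 1))
  simp only [intervalIntegral.integral_same, add_zero] at e1
  rw [setIntegral_unitI]
  simp only at e2
  linarith

/-- `z` belongs to `H¹(I)` and `k` is its weak derivative. -/
structure HasL2Deriv (z k : ℝ → ℝ) : Prop where
  hasWeakDeriv : HasWeakDeriv 1 z k
  memL2 : MemL2 z
  memL2_deriv : MemL2 k

theorem HasL2Deriv.add {z k w l : ℝ → ℝ} (hz : HasL2Deriv z k) (hw : HasL2Deriv w l) :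
    HasL2Deriv (z + w) (k + l) :=
  ⟨hz.hasWeakDeriv.add hw.hasWeakDeriv, MemLp.add hz.memL2 hw.memL2,
    MemLp.add hz.memL2_deriv hw.memL2_deriv⟩

theorem HasL2Deriv.const_smul {z k : ℝ → ℝ} (hz : HasL2Deriv z k) (c : ℝ) :
    HasL2Deriv (c • z) (c • k) :=
  ⟨hz.hasWeakDeriv.const_smul c, MemLp.const_smul hz.memL2 c, MemLp.const_smul hz.memL2_deriv c⟩

theorem memL2_of_continuousOn {v : ℝ → ℝ} (hv : ContinuousOn v (Icc (-1) 1)) : MemL2 v := by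
  obtain ⟨C, hC⟩ := isCompact_Icc.exists_bound_of_continuousOn hv
  refine MemLp.of_bound ((hv.mono Ioo_subset_Icc_self).aestronglyMeasurable measurableSet_Ioo) C ?_
  exact (ae_restrict_iff' measurableSet_Ioo).2
    (Filter.Eventually.of_forall fun x hx => hC x (Ioo_subset_Icc_self hx))

theorem hasL2Deriv_primitive {k : ℝ → ℝ} (hk : MemL2 k) (c : ℝ) :
    HasL2Deriv (fun x => c + ∫ t in (-1 : ℝ)..x, k t) k :=
  ⟨hasWeakDeriv_primitive hk.integrableOn c,
    memL2_of_continuousOn (continuousOn_const.add (continuousOn_primitive_unitI hk.integrableOn)),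
    hk⟩

theorem memH_two {v g r : ℝ → ℝ} (hg : HasL2Deriv v g) (hr : HasL2Deriv g r) : MemH 2 v := by
  have h2 := hg.hasWeakDeriv.succ_of_one hr.hasWeakDeriv
  have h0 := HasWeakDeriv.zero_order hg.hasWeakDeriv.locallyIntegrable
  have hfl : ⌊(2 : ℝ)⌋₊ = 2 := by norm_num
  refine ⟨by norm_num, fun k hk => ?_, fun k hk => ?_, fun h => ?_⟩
  · rw [hfl] at hk
    interval_cases k
    exacts [h0.weakDeriv, hg.hasWeakDeriv.weakDeriv, h2.weakDeriv]
  · rw [hfl] at hk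
    interval_cases k
    exacts [(memLp_congr_ae h0.weakDeriv_ae).2 hg.memL2,
      (memLp_congr_ae hg.hasWeakDeriv.weakDeriv_ae).2 hg.memL2_deriv,
      (memLp_congr_ae h2.weakDeriv_ae).2 hr.memL2_deriv]
  · exact absurd (Int.fract_ofNat 2) h

theorem MemH.memL2_self {s : ℝ} {v : ℝ → ℝ} (hv : MemH s v) : MemL2 v := by
  have h := hv.hasWeakDeriv 0 (Nat.zero_le _)
  exact (memLp_congr_ae (HasWeakDeriv.zero_order h.locallyIntegrable).weakDeriv_ae).1
    (hv.memL2 0 (Nat.zero_le _))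

theorem MemH.hasL2Deriv {s : ℝ} {v : ℝ → ℝ} (hv : MemH s v) (hs : 1 ≤ s) :
    HasL2Deriv v (weakDeriv 1 v) :=
  have h1 : 1 ≤ ⌊s⌋₊ := Nat.le_floor (by simpa using hs)
  ⟨hv.hasWeakDeriv 1 h1, hv.memL2_self, hv.memL2 1 h1⟩

theorem MemH.hasL2Deriv_weakDeriv {s : ℝ} {v : ℝ → ℝ} (hv : MemH s v) (hs : 2 ≤ s) :
    HasL2Deriv (weakDeriv 1 v) (weakDeriv 2 v) :=
  have h2 : 2 ≤ ⌊s⌋₊ := Nat.le_floor (by simpa using hs)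
  ⟨(hv.hasWeakDeriv 1 (by omega)).one_of_succ (hv.hasWeakDeriv 2 h2), hv.memL2 1 (by omega),
    hv.memL2 2 h2⟩

/-! ### The variational inequality in terms of the derivative. -/

/-- The derivative of the quadratic cost functional in the direction of the primitive of `z`. -/
def costDeriv (D F z k : ℝ → ℝ) : ℝ :=
  (∫ x in unitI, D x * ∫ t in (-1 : ℝ)..x, z t) + ∫ x in unitI, F x * k x

theorem integrableOn_mul_primitive {D z : ℝ → ℝ} (hD : IntegrableOn D unitI)
    (hz : IntegrableOn z unitI) :
    IntegrableOn (fun x => D x * ∫ t in (-1 : ℝ)..x, z t) unitI :=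
  (((integrableOn_Icc_iff_integrableOn_Ioo).2 hD).mul_continuousOn
    (continuousOn_primitive_unitI hz) isCompact_Icc).mono_set Ioo_subset_Icc_self

theorem MemL2.integrableOn_mul {v w : ℝ → ℝ} (hv : MemL2 v) (hw : MemL2 w) :
    IntegrableOn (fun x => v x * w x) unitI :=
  MemLp.integrable_mul hv hw

theorem intervalIntegrable_of_mem {z : ℝ → ℝ} (hz : IntegrableOn z unitI) {x : ℝ}
    (hx : x ∈ unitI) : IntervalIntegrable z volume (-1) x := by
  refine (intervalIntegrable_iff_unitI.2 hz).mono_set ?_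
  rw [uIcc_of_le hx.1.le, uIcc_of_le (by norm_num)]
  exact Icc_subset_Icc_right hx.2.le

theorem costDeriv_add {D F z k w l : ℝ → ℝ} (hD : MemL2 D) (hF : MemL2 F) (hz : MemL2 z)
    (hk : MemL2 k) (hw : MemL2 w) (hl : MemL2 l) :
    costDeriv D F (z + w) (k + l) = costDeriv D F z k + costDeriv D F w l := by
  unfold costDeriv
  have e1 : ∫ x in unitI, D x * ∫ t in (-1 : ℝ)..x, (z + w) t
      = ∫ x in unitI, (D x * (∫ t in (-1 : ℝ)..x, z t) + D x * ∫ t in (-1 : ℝ)..x, w t) := by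
    refine setIntegral_congr_fun measurableSet_Ioo fun x hx => ?_
    simp only [Pi.add_apply]
    rw [intervalIntegral.integral_add (intervalIntegrable_of_mem hz.integrableOn hx)
      (intervalIntegrable_of_mem hw.integrableOn hx), mul_add]
  rw [e1, integral_add (integrableOn_mul_primitive hD.integrableOn hz.integrableOn)
    (integrableOn_mul_primitive hD.integrableOn hw.integrableOn)]
  simp only [Pi.add_apply, mul_add]
  rw [integral_add (hF.integrableOn_mul hk) (hF.integrableOn_mul hl)]
  ring

theorem costDeriv_smul (D F z k : ℝ → ℝ) (c : ℝ) :
    costDeriv D F (c • z) (c • k) = c * costDeriv D F z k := by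
  simp only [costDeriv, Pi.smul_apply, smul_eq_mul, intervalIntegral.integral_const_mul,
    mul_left_comm _ c, integral_const_mul, mul_add]

/-- The primitive of z is bounded by ‖z‖₁. An L¹ bound is essential: it becomes small for the narrow
test directions used later. -/
theorem costDeriv_le {D F z k : ℝ → ℝ} (hD : MemL2 D) (hz : MemL2 z) :
    costDeriv D F z k ≤ (∫ x in unitI, |D x|) * (∫ x in unitI, |z x|)
      + ∫ x in unitI, F x * k x := by
  unfold costDeriv
  gcongr
  rw [← integral_mul_const]
  refine setIntegral_mono_on (integrableOn_mul_primitive hD.integrableOn hz.integrableOn)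
    (hD.integrableOn.abs.mul_const _) measurableSet_Ioo fun x hx => ?_
  refine (le_abs_self _).trans ?_
  rw [abs_mul]
  gcongr
  refine (intervalIntegral.abs_integral_le_integral_abs hx.1.le).trans ?_
  rw [intervalIntegral.integral_of_le hx.1.le]
  exact setIntegral_mono_set hz.integrableOn.abs
    (Filter.Eventually.of_forall fun _ => abs_nonneg _)
    (Filter.Eventually.of_forall fun t ht => ⟨ht.1, ht.2.trans_lt hx.2⟩)

/-- The competitor is ȳ plus the primitive of z; mean value zero is the boundary condition at 1, and
the upper bound on z is the derivative constraint. -/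
theorem IsSolution.costDeriv_nonneg {β : ℝ} {yd f ψ ybar : ℝ → ℝ}
    (h : IsSolution β yd f ψ ybar) {z k : ℝ → ℝ} (hz : HasL2Deriv z k)
    (hle : ∀ᵐ x ∂(volume.restrict unitI), z x ≤ ψ x - weakDeriv 1 ybar x)
    (h0 : ∫ x in unitI, z x = 0) :
    0 ≤ costDeriv (fun x => ybar x - yd x)
      (fun x => β * (weakDeriv 2 ybar x + f x)) z k := by
  have hV := h.memK.memV
  have hp := hV.memH.hasL2Deriv (by norm_num)
  have hr := hV.memH.hasL2Deriv_weakDeriv le_rfl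
  have hZ := hasL2Deriv_primitive hz.memL2 0
  set y : ℝ → ℝ := ybar + fun x => 0 + ∫ t in (-1 : ℝ)..x, z t
  have hy := hp.add hZ
  have hyr := hr.add hz
  have hy2 := hy.hasWeakDeriv.succ_of_one hyr.hasWeakDeriv
  have hyK : MemK ψ y := by
    refine ⟨⟨memH_two hy hyr, ?_, ?_, ?_⟩, ?_⟩
    · exact hV.continuousOn.add
        (continuousOn_const.add (continuousOn_primitive_unitI hz.memL2.integrableOn))
    · simp [y, hV.left]
    · simp [y, hV.right, ← setIntegral_unitI, h0]
    · filter_upwards [hy.hasWeakDeriv.weakDeriv_ae, hle] with x hx hx'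
      rw [hx, Pi.add_apply]
      linarith
  refine (h.ineq y hyK).trans_eq ?_
  unfold costDeriv
  rw [← integral_const_mul]
  congr 1
  · simp [y]
  · refine integral_congr_ae ?_
    filter_upwards [hy2.weakDeriv_ae] with x hx
    rw [hx, Pi.add_apply]
    ring

/-! ### Removing the mean value constraint. -/

/-- Lagrange multiplier rule for one scalar equality constraint, under Slater's condition. -/
theorem exists_multiplier {E : Type*} [AddCommGroup E] [Module ℝ E] {C : Set E} {L m : E → ℝ}
    (hC : Convex ℝ C)
    -- Linearity is asked only on C: integrals are additive only on integrable functions, so the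
    -- functionals in the application need not be linear on all of E.
    (hL : ∀ u ∈ C, ∀ v ∈ C, ∀ s t : ℝ, L (s • u + t • v) = s * L u + t * L v)
    (hm : ∀ u ∈ C, ∀ v ∈ C, ∀ s t : ℝ, m (s • u + t • v) = s * m u + t * m v)
    (hpos : ∃ u ∈ C, 0 < m u) (hneg : ∃ u ∈ C, m u < 0)
    (h0 : ∀ u ∈ C, m u = 0 → 0 ≤ L u) :
    ∃ l : ℝ, ∀ u ∈ C, l * m u ≤ L u := by
  -- The segment from u to v meets m = 0, where L ≥ 0; this separates the quotients L / m on the two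
  -- sides.
  have key : ∀ u ∈ C, 0 < m u → ∀ v ∈ C, m v < 0 → L v / m v ≤ L u / m u := by
    intro u hu hmu v hv hmv
    have hd : 0 < m u - m v := by linarith
    have hmem := hC hu hv (a := -m v / (m u - m v)) (b := m u / (m u - m v))
      (div_nonneg (by linarith) hd.le) (div_nonneg hmu.le hd.le) (by field_simp; ring)
    have h1 := h0 _ hmem (by rw [hm u hu v hv]; field_simp; ring)
    rw [hL u hu v hv] at h1
    have h2 : 0 ≤ -m v * L u + m u * L v := by
      have h3 := mul_nonneg hd.le h1
      field_simp at h3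
      linarith
    rw [div_le_iff_of_neg hmv, div_mul_eq_mul_div, div_le_iff₀ hmu]
    linarith
  set S : Set ℝ := {r | ∃ u ∈ C, 0 < m u ∧ r = L u / m u}
  obtain ⟨u0, hu0, hmu0⟩ := hpos
  obtain ⟨v0, hv0, hmv0⟩ := hneg
  have hS : S.Nonempty := ⟨_, u0, hu0, hmu0, rfl⟩
  have hB : BddBelow S := ⟨L v0 / m v0, by
    rintro _ ⟨u, hu, hmu, rfl⟩; exact key u hu hmu v0 hv0 hmv0⟩
  -- Any number between the two families of quotients is a multiplier; the infimum of the upper one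
  -- is chosen.
  refine ⟨sInf S, fun u hu => ?_⟩
  rcases lt_trichotomy (m u) 0 with hmu | hmu | hmu
  · rw [← div_le_iff_of_neg hmu]
    refine le_csInf hS ?_
    rintro _ ⟨w, hw, hmw, rfl⟩
    exact key w hw hmw u hu hmu
  · rw [hmu, mul_zero]; exact h0 u hu hmu
  · rw [← le_div_iff₀ hmu]
    exact csInf_le hB ⟨u, hu, hmu, rfl⟩

/-- Elimination of the mean value constraint: a functional that is nonnegative on the admissible
directions of mean value zero is bounded below by `-M ‖z‖₁` on all nonpositive directions, up to
its part of highest order. -/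
theorem exists_bound_of_costDeriv_nonneg {D F g g' : ℝ → ℝ} (hD : MemL2 D) (hF : MemL2 F)
    (hg : HasL2Deriv g g') (hg0 : ∀ᵐ x ∂(volume.restrict unitI), 0 ≤ g x)
    (hgpos : 0 < ∫ x in unitI, g x)
    (H : ∀ z k : ℝ → ℝ, HasL2Deriv z k → (∀ᵐ x ∂(volume.restrict unitI), z x ≤ g x) →
      ∫ x in unitI, z x = 0 → 0 ≤ costDeriv D F z k) :
    ∃ M : ℝ, 0 ≤ M ∧ ∀ z k : ℝ → ℝ, HasL2Deriv z k →
      (∀ᵐ x ∂(volume.restrict unitI), z x ≤ 0) →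
      0 ≤ (∫ x in unitI, F x * k x) + M * ∫ x in unitI, |z x| := by
  -- Elements are pairs of a function and a weak derivative of it, so that no representative of the
  -- derivative has to be selected linearly.
  let C : Set ((ℝ → ℝ) × (ℝ → ℝ)) := {u | HasL2Deriv u.1 u.2 ∧
    ∀ᵐ x ∂(volume.restrict unitI), u.1 x ≤ g x}
  have hconv : Convex ℝ C := by
    rintro u ⟨hu, hu'⟩ v ⟨hv, hv'⟩ s t hs ht hst
    refine ⟨(hu.const_smul s).add (hv.const_smul t), ?_⟩
    filter_upwards [hu', hv'] with x h1 h2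
    have e : g x = s * g x + t * g x := by rw [← add_mul, hst, one_mul]
    rw [e]
    exact add_le_add (mul_le_mul_of_nonneg_left h1 hs) (mul_le_mul_of_nonneg_left h2 ht)
  have hL : ∀ u ∈ C, ∀ v ∈ C, ∀ s t : ℝ,
      costDeriv D F (s • u + t • v).1 (s • u + t • v).2
        = s * costDeriv D F u.1 u.2 + t * costDeriv D F v.1 v.2 := by
    rintro u ⟨hu, -⟩ v ⟨hv, -⟩ s t
    have hu1 := hu.const_smul s
    have hv1 := hv.const_smul t
    rw [← costDeriv_smul, ← costDeriv_smul]
    exact costDeriv_add hD hF hu1.memL2 hu1.memL2_deriv hv1.memL2 hv1.memL2_deriv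
  have hm : ∀ u ∈ C, ∀ v ∈ C, ∀ s t : ℝ, ∫ x in unitI, (s • u + t • v).1 x
      = s * (∫ x in unitI, u.1 x) + t * ∫ x in unitI, v.1 x := by
    rintro u ⟨hu, -⟩ v ⟨hv, -⟩ s t
    rw [← integral_const_mul, ← integral_const_mul]
    exact integral_add (hu.memL2.integrableOn.const_mul s) (hv.memL2.integrableOn.const_mul t)
  have hneg : ∃ u ∈ C, ∫ x in unitI, u.1 x < 0 := by
    refine ⟨(fun x => -1 + ∫ t in (-1 : ℝ)..x, (0 : ℝ → ℝ) t, 0),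
      ⟨hasL2Deriv_primitive MemLp.zero (-1), ?_⟩, ?_⟩
    · filter_upwards [hg0] with x hx
      simp
      linarith
    · simp
  obtain ⟨l, hl⟩ := exists_multiplier hconv (L := fun u => costDeriv D F u.1 u.2)
    (m := fun u => ∫ x in unitI, u.1 x) hL hm
    ⟨(g, g'), ⟨hg, Filter.Eventually.of_forall fun _ => le_rfl⟩, hgpos⟩ hneg
    fun u hu hu0 => H u.1 u.2 hu.1 hu.2 hu0
  refine ⟨(∫ x in unitI, |D x|) + |l|, by positivity, fun z k hz hz0 => ?_⟩
  have hzC : (z, k) ∈ C := ⟨hz, by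
    filter_upwards [hz0, hg0] with x h1 h2
    exact h1.trans h2⟩
  have h1 : l * (∫ x in unitI, z x) ≤ _ := (hl _ hzC).trans (costDeriv_le hD hz.memL2)
  have h2 : -(|l| * ∫ x in unitI, |z x|) ≤ l * ∫ x in unitI, z x := by
    rw [neg_le, ← mul_neg]
    refine (le_abs_self _).trans ?_
    rw [abs_mul, abs_neg]
    gcongr
    exact abs_integral_le_integral_abs
  linarith

/-! ### Ramp test functions and monotonicity of F + M x. -/

/-- The normalized indicator function of `(a, a + h]`. -/
def avgKernel (a h : ℝ) : ℝ → ℝ := (Ioc a (a + h)).indicator fun _ => h⁻¹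

/-- The continuous ramp that rises from `0` to `1` on `[a, a + h]`. -/
def ramp (a h x : ℝ) : ℝ := ∫ t in (-1 : ℝ)..x, avgKernel a h t

theorem memL2_avgKernel (a h : ℝ) : MemL2 (avgKernel a h) :=
  (memLp_const h⁻¹).indicator measurableSet_Ioc

theorem hasL2Deriv_ramp (a h : ℝ) : HasL2Deriv (ramp a h) (avgKernel a h) := by
  have h0 := hasL2Deriv_primitive (memL2_avgKernel a h) 0
  simp only [zero_add] at h0
  exact h0

theorem ramp_eq {a h x : ℝ} (ha : -1 ≤ a) (hx : -1 ≤ x) :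
    ramp a h x = h⁻¹ * max (min x (a + h) - a) 0 := by
  unfold ramp avgKernel
  rw [intervalIntegral.integral_of_le hx, setIntegral_indicator measurableSet_Ioc, Ioc_inter_Ioc,
    setIntegral_const, Real.volume_real_Ioc, max_eq_right ha, smul_eq_mul, mul_comm]

theorem ramp_nonneg {a h x : ℝ} (ha : -1 ≤ a) (hh : 0 < h) (hx : -1 ≤ x) : 0 ≤ ramp a h x := by
  rw [ramp_eq ha hx]; positivity

theorem ramp_le_one {a h x : ℝ} (ha : -1 ≤ a) (hh : 0 < h) (hx : -1 ≤ x) : ramp a h x ≤ 1 := by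
  rw [ramp_eq ha hx, inv_mul_le_iff₀ hh, mul_one]
  exact max_le (by linarith [min_le_right x (a + h)]) hh.le

theorem ramp_of_le {a h x : ℝ} (ha : -1 ≤ a) (hx : -1 ≤ x) (hxa : x ≤ a) : ramp a h x = 0 := by
  rw [ramp_eq ha hx, max_eq_right (by linarith [min_le_left x (a + h)]), mul_zero]

theorem ramp_of_ge {a h x : ℝ} (ha : -1 ≤ a) (hh : 0 < h) (hx : -1 ≤ x) (hxa : a + h ≤ x) :
    ramp a h x = 1 := by
  rw [ramp_eq ha hx, min_eq_right hxa, add_sub_cancel_left, max_eq_left hh.le,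
    inv_mul_cancel₀ hh.ne']

/-- Makes `ramp b h - ramp a h` a nonpositive test direction. -/
theorem ramp_anti {a b h x : ℝ} (ha : -1 ≤ a) (hab : a ≤ b) (hh : 0 < h) (hx : -1 ≤ x) :
    ramp b h x ≤ ramp a h x := by
  rw [ramp_eq ha hx, ramp_eq (ha.trans hab) hx]
  gcongr ?_ * ?_
  refine max_le_max ?_ le_rfl
  rw [← min_sub_sub_right, ← min_sub_sub_right]
  exact min_le_min (by linarith) (by linarith)

theorem setIntegral_mul_avgKernel (F : ℝ → ℝ) {a h : ℝ} (ha : -1 < a) (hh : 0 < h)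
    (hah : a + h < 1) :
    ∫ x in unitI, F x * avgKernel a h x = h⁻¹ * ∫ x in a..(a + h), F x := by
  have e : (fun x => F x * avgKernel a h x)
      = (Ioc a (a + h)).indicator fun x => h⁻¹ * F x := by
    ext x
    by_cases hx : x ∈ Ioc a (a + h) <;> simp [avgKernel, hx, mul_comm]
  rw [e, setIntegral_indicator measurableSet_Ioc, inter_eq_right.2, integral_const_mul,
    intervalIntegral.integral_of_le (by linarith)]
  exact fun x hx => ⟨ha.trans hx.1, hx.2.trans_lt hah⟩

theorem tendsto_average_right {F : ℝ → ℝ} (hF : IntegrableOn F unitI) :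
    ∀ᵐ a ∂(volume.restrict unitI), Filter.Tendsto (fun h => h⁻¹ * ∫ x in a..(a + h), F x)
      (nhdsWithin 0 (Ioi 0)) (nhds (F a)) := by
  refine (ae_restrict_iff' measurableSet_Ioo).2 ?_
  filter_upwards [(intervalIntegrable_iff_unitI.2 hF).ae_hasDerivAt_integral] with a ha haI
  have haI' : a ∈ uIcc (-1 : ℝ) 1 := by
    rw [uIcc_of_le (by norm_num)]; exact Ioo_subset_Icc_self haI
  simpa using (ha haI' a haI').tendsto_slope_zero_right

theorem eventually_add_lt_one {a : ℝ} (ha : a ∈ unitI) :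
    ∀ᶠ h in nhdsWithin (0 : ℝ) (Ioi 0), 0 < h ∧ a + h < 1 := by
  filter_upwards [Ioo_mem_nhdsGT (show (0 : ℝ) < 1 - a by linarith [ha.2])] with h hh
  exact ⟨hh.1, by linarith [hh.2]⟩

theorem ae_unitI_of_forall {p : ℝ → Prop} (h : ∀ x ∈ unitI, p x) :
    ∀ᵐ x ∂(volume.restrict unitI), p x :=
  (ae_restrict_iff' measurableSet_Ioo).2 (Filter.Eventually.of_forall h)

theorem setIntegral_abs_le_two {z : ℝ → ℝ} (hz : ∀ x ∈ unitI, |z x| ≤ 1) :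
    ∫ x in unitI, |z x| ≤ 2 := by
  have := norm_setIntegral_le_of_norm_le_const (μ := volume) (s := unitI) (f := fun x => |z x|)
    (C := 1) (by simp) (fun x hx => by simpa using hz x hx)
  rw [Real.norm_eq_abs, Real.volume_real_Ioo] at this
  norm_num at this
  exact (le_abs_self _).trans this

/-- A function `F` such that `z ↦ ∫ F z'` is bounded below by `-M ‖z‖₁` on nonpositive functions
agrees almost everywhere with a monotone function up to the linear term `M x`. -/
theorem exists_monotone_of_bound {F : ℝ → ℝ} (hF : MemL2 F) {M : ℝ} (hM : 0 ≤ M)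
    (H : ∀ z k : ℝ → ℝ, HasL2Deriv z k → (∀ᵐ x ∂(volume.restrict unitI), z x ≤ 0) →
      0 ≤ (∫ x in unitI, F x * k x) + M * ∫ x in unitI, |z x|) :
    ∃ G : ℝ → ℝ, Monotone G ∧ F =ᵐ[volume.restrict unitI] fun x => G x - M * x := by
  have hone : HasL2Deriv (fun x => -1 + ∫ t in (-1 : ℝ)..x, (0 : ℝ → ℝ) t) 0 :=
    hasL2Deriv_primitive MemLp.zero (-1)
  -- Test with minus a ramp; its L¹ norm is at most |I| = 2. The lower bound below uses -1 plus a
  -- ramp.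
  have upper : ∀ a h : ℝ, -1 < a → 0 < h → a + h < 1 →
      h⁻¹ * ∫ x in a..(a + h), F x ≤ 2 * M := by
    intro a h ha hh hah
    have h1 := H _ _ ((hasL2Deriv_ramp a h).const_smul (-1)) (ae_unitI_of_forall fun x hx => by
      simpa using ramp_nonneg ha.le hh hx.1.le)
    have h2 := setIntegral_abs_le_two (z := (-1 : ℝ) • ramp a h) fun x hx => by
      rw [Pi.smul_apply, smul_eq_mul, abs_mul, abs_neg, abs_one, one_mul,
        abs_of_nonneg (ramp_nonneg ha.le hh hx.1.le)]
      exact ramp_le_one ha.le hh hx.1.le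
    have h3 : ∫ x in unitI, F x * ((-1 : ℝ) • avgKernel a h) x
        = -(h⁻¹ * ∫ x in a..(a + h), F x) := by
      rw [← setIntegral_mul_avgKernel F ha hh hah, ← integral_neg]
      simp
    rw [h3] at h1
    nlinarith
  have lower : ∀ a h : ℝ, -1 < a → 0 < h → a + h < 1 →
      -(2 * M) ≤ h⁻¹ * ∫ x in a..(a + h), F x := by
    intro a h ha hh hah
    have h1 := H _ _ (hone.add (hasL2Deriv_ramp a h)) (ae_unitI_of_forall fun x hx => by
      have := ramp_le_one ha.le hh hx.1.le
      simp
      linarith)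
    have h2 := setIntegral_abs_le_two
      (z := (fun x => -1 + ∫ t in (-1 : ℝ)..x, (0 : ℝ → ℝ) t) + ramp a h) fun x hx => by
      have h3 := ramp_le_one ha.le hh hx.1.le
      have h4 := ramp_nonneg ha.le hh hx.1.le
      simp only [Pi.add_apply, Pi.zero_apply, intervalIntegral.integral_zero, add_zero]
      rw [abs_le]
      constructor <;> linarith
    rw [zero_add, setIntegral_mul_avgKernel F ha hh hah] at h1
    nlinarith
  -- Test with the difference of the ramps at b and a: it vanishes off [a, b + h] and is bounded by
  -- 1 there, whence the length b - a + h.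
  have mono : ∀ a b h : ℝ, -1 < a → a ≤ b → 0 < h → b + h < 1 →
      h⁻¹ * ∫ x in a..(a + h), F x ≤ (h⁻¹ * ∫ x in b..(b + h), F x) + M * (b - a + h) := by
    intro a b h ha hab hh hbh
    have h1 := H _ _ ((hasL2Deriv_ramp b h).add ((hasL2Deriv_ramp a h).const_smul (-1)))
      (ae_unitI_of_forall fun x hx => by
        have := ramp_anti ha.le hab hh hx.1.le
        simpa using this)
    have h2 : ∫ x in unitI, |(ramp b h + (-1 : ℝ) • ramp a h) x| ≤ b - a + h := by
      have h3 : ∫ x in unitI, |(ramp b h + (-1 : ℝ) • ramp a h) x|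
          = ∫ x in Icc a (b + h), |(ramp b h + (-1 : ℝ) • ramp a h) x| := by
        refine setIntegral_eq_of_subset_of_forall_sdiff_eq_zero measurableSet_Ioo
          (fun x hx => ⟨ha.trans_le hx.1, hx.2.trans_lt hbh⟩) fun x hx => ?_
        have hx2 := hx.2
        have hx1 := hx.1.1.le
        rw [mem_Icc, not_and_or, not_le, not_le] at hx2
        rcases hx2 with hx2 | hx2
        · simp [ramp_of_le ha.le hx1 hx2.le, ramp_of_le (ha.le.trans hab) hx1 (hx2.le.trans hab)]
        · simp [ramp_of_ge ha.le hh hx1 (by linarith),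
            ramp_of_ge (ha.le.trans hab) hh hx1 hx2.le]
      have h4 := norm_setIntegral_le_of_norm_le_const (μ := volume) (s := Icc a (b + h))
        (f := fun x => |(ramp b h + (-1 : ℝ) • ramp a h) x|) (C := 1) (by simp) (fun x hx => by
          have hx1 : -1 ≤ x := ha.le.trans hx.1
          have e1 := ramp_le_one ha.le hh hx1
          have e2 := ramp_nonneg ha.le hh hx1
          have e3 := ramp_le_one (ha.le.trans hab) hh hx1
          have e4 := ramp_nonneg (ha.le.trans hab) hh hx1
          simp only [Pi.add_apply, Pi.smul_apply, smul_eq_mul, norm_abs_eq_norm, Real.norm_eq_abs,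
            abs_le]
          constructor <;> linarith)
      rw [Real.norm_eq_abs, Real.volume_real_Icc, max_eq_left (by linarith)] at h4
      rw [h3]
      linarith [le_abs_self (∫ x in Icc a (b + h), |(ramp b h + (-1 : ℝ) • ramp a h) x|)]
    have h3 : ∫ x in unitI, F x * (avgKernel b h + (-1 : ℝ) • avgKernel a h) x
        = (h⁻¹ * ∫ x in b..(b + h), F x) - h⁻¹ * ∫ x in a..(a + h), F x := by
      rw [← setIntegral_mul_avgKernel F ha hh (by linarith),
        ← setIntegral_mul_avgKernel F (ha.trans_le hab) hh hbh,
        ← integral_sub (hF.integrableOn_mul (memL2_avgKernel b h))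
          (hF.integrableOn_mul (memL2_avgKernel a h))]
      congr 1
      ext x
      simp
      ring
    rw [h3] at h1
    nlinarith [mul_le_mul_of_nonneg_left h2 hM]
  let S : Set ℝ := {a | a ∈ unitI ∧ Filter.Tendsto (fun h => h⁻¹ * ∫ x in a..(a + h), F x)
      (nhdsWithin 0 (Ioi 0)) (nhds (F a))}
  have hmono : MonotoneOn (fun x => F x + M * x) S := by
    rintro a ⟨haI, ha⟩ b ⟨hbI, hb⟩ hab
    have hlim : Filter.Tendsto
        (fun h => (h⁻¹ * ∫ x in b..(b + h), F x) + M * (b - a + h))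
        (nhdsWithin 0 (Ioi 0)) (nhds (F b + M * (b - a + 0))) := by
      refine hb.add (Filter.Tendsto.const_mul M (Filter.Tendsto.const_add _ ?_))
      exact Filter.tendsto_id.mono_left nhdsWithin_le_nhds
    have := le_of_tendsto_of_tendsto ha hlim (by
      filter_upwards [eventually_add_lt_one hbI] with h hh
      exact mono a b h haI.1 hab hh.1 hh.2)
    simp only
    linarith
  have hle : ∀ a ∈ S, |F a| ≤ 2 * M := by
    rintro a ⟨haI, ha⟩
    refine abs_le.2 ⟨ge_of_tendsto ha ?_, le_of_tendsto ha ?_⟩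
    · filter_upwards [eventually_add_lt_one haI] with h hh
      exact lower a h haI.1 hh.1 hh.2
    · filter_upwards [eventually_add_lt_one haI] with h hh
      exact upper a h haI.1 hh.1 hh.2
  -- A monotone extension from S to the whole line needs bounds: |F| ≤ 2M on S and |M x| ≤ M on I
  -- add up to 3M.
  obtain ⟨G, hG, hGS⟩ := hmono.exists_monotone_extension
    ⟨-(3 * M), by
      rintro _ ⟨a, ha, rfl⟩
      have := (abs_le.1 (hle a ha)).1
      simp only
      nlinarith [ha.1.1]⟩
    ⟨3 * M, by
      rintro _ ⟨a, ha, rfl⟩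
      have := (abs_le.1 (hle a ha)).2
      simp only
      nlinarith [ha.1.2]⟩
  refine ⟨G, hG, ?_⟩
  filter_upwards [tendsto_average_right hF.integrableOn, ae_restrict_mem measurableSet_Ioo]
    with x hx hxI
  have : G x = F x + M * x := (hGS ⟨hxI, hx⟩).symm
  rw [this]; ring

/-! ### Gagliardo seminorms and monotone functions. -/

theorem gagliardoSq_congr {σ : ℝ} {g h : ℝ → ℝ} (hgh : g =ᵐ[volume.restrict unitI] h) :
    gagliardoSq σ g = gagliardoSq σ h := by
  unfold gagliardoSq
  refine lintegral_congr_ae ?_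
  filter_upwards [hgh] with x hx
  refine lintegral_congr_ae ?_
  filter_upwards [hgh] with y hy
  rw [hx, hy]

theorem gagliardoSq_const_mul (σ c : ℝ) (g : ℝ → ℝ) :
    gagliardoSq σ (fun x => c * g x) = ENNReal.ofReal (c ^ 2) * gagliardoSq σ g := by
  unfold gagliardoSq
  rw [← lintegral_const_mul' _ _ ENNReal.ofReal_ne_top]
  congr 1; ext x
  rw [← lintegral_const_mul' _ _ ENNReal.ofReal_ne_top]
  congr 1; ext y
  rw [← ENNReal.ofReal_mul (sq_nonneg c)]
  congr 1
  ring

theorem measurable_gagliardo_kernel {g : ℝ → ℝ} (hg : Measurable g) (r : ℝ) :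
    Measurable fun q : ℝ × ℝ => ENNReal.ofReal ((g q.1 - g q.2) ^ 2 / |q.1 - q.2| ^ r) := by
  fun_prop

/-- Additivity of the lower integral needs only one measurable summand, so the other may come from
f, which is measurable merely up to a null set. -/
theorem lintegral_lintegral_le_const_mul_add {α : Type*} [MeasurableSpace α] {μ : Measure α}
    [SFinite μ] {K K₁ K₂ : α → α → ℝ≥0∞} {c : ℝ≥0∞} (hc : c ≠ ⊤)
    (hm : Measurable (Function.uncurry K₁)) (hK : ∀ x y, K x y ≤ c * (K₁ x y + K₂ x y)) :
    ∫⁻ x, ∫⁻ y, K x y ∂μ ∂μ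
      ≤ c * (∫⁻ x, ∫⁻ y, K₁ x y ∂μ ∂μ + ∫⁻ x, ∫⁻ y, K₂ x y ∂μ ∂μ) := by
  have hm' : Measurable fun x => ∫⁻ y, K₁ x y ∂μ := hm.lintegral_prod_right'
  rw [← lintegral_add_left hm', ← lintegral_const_mul' _ _ hc]
  refine lintegral_mono fun x => ?_
  have hx : Measurable (K₁ x) := hm.comp measurable_prodMk_left
  change _ ≤ c * (∫⁻ y, K₁ x y ∂μ + ∫⁻ y, K₂ x y ∂μ)
  rw [← lintegral_add_left hx, ← lintegral_const_mul' _ _ hc]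
  exact lintegral_mono fun y => hK x y

theorem gagliardoSq_sub_lt_top {σ : ℝ} {g h : ℝ → ℝ} (hm : Measurable g)
    (hg : gagliardoSq σ g < ⊤) (hh : gagliardoSq σ h < ⊤) :
    gagliardoSq σ (fun x => g x - h x) < ⊤ := by
  refine (lintegral_lintegral_le_const_mul_add (c := ENNReal.ofReal 2) ENNReal.ofReal_ne_top
    (measurable_gagliardo_kernel hm (1 + 2 * σ)) fun x y => ?_).trans_lt
    (ENNReal.mul_lt_top ENNReal.ofReal_lt_top (ENNReal.add_lt_top.2 ⟨hg, hh⟩))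
  rw [← ENNReal.ofReal_add (by positivity) (by positivity), ← ENNReal.ofReal_mul (by norm_num),
    ← add_div, ← mul_div_assoc]
  refine ENNReal.ofReal_le_ofReal (div_le_div_of_nonneg_right ?_ (by positivity))
  nlinarith [sq_nonneg ((g x - g y) + (h x - h y))]

theorem intervalIntegrable_abs_rpow {r : ℝ} (hr : -1 < r) :
    IntervalIntegrable (fun x : ℝ => |x| ^ r) volume (-2) 2 := by
  have h1 : IntervalIntegrable (fun x : ℝ => |x| ^ r) volume 0 2 := by
    refine (intervalIntegral.intervalIntegrable_rpow' hr).congr fun x hx => ?_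
    rw [uIoc_of_le (by norm_num)] at hx
    simp only [abs_of_pos hx.1]
  have h2 := ((IntervalIntegrable.iff_comp_neg (by finiteness)).1 h1).symm
  simp only [abs_neg, neg_zero] at h2
  exact h2.trans h1

/-- The `L¹` modulus of continuity of a monotone function is linear. -/
theorem Monotone.lintegral_abs_sub_le {G : ℝ → ℝ} (hG : Monotone G) {h : ℝ}
    (hh : h ∈ Ioo (-2 : ℝ) 2) :
    ∫⁻ x in unitI, ENNReal.ofReal |G x - G (x + h)| ≤ ENNReal.ofReal ((G 3 - G (-3)) * |h|) := by
  have hi : ∀ a b, IntervalIntegrable G volume a b := fun a b => hG.intervalIntegrable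
  have hi' : IntervalIntegrable (fun x => G (x + h)) volume (-1) 1 :=
    (hG.comp fun x y hxy => by simpa using hxy : Monotone fun x => G (x + h)).intervalIntegrable
  have hint : IntegrableOn (fun x => |G x - G (x + h)|) unitI :=
    ((intervalIntegrable_iff_integrableOn_Ioo_of_le (by norm_num)).1 ((hi (-1) 1).sub hi')).abs
  rw [← ofReal_integral_eq_lintegral_ofReal hint
    (Filter.Eventually.of_forall fun x => abs_nonneg _)]
  refine ENNReal.ofReal_le_ofReal ?_
  -- By monotonicity the integrand has a constant sign.
  have e1 : ∫ x in unitI, |G x - G (x + h)| = |∫ x in unitI, (G x - G (x + h))| := by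
    rcases le_total 0 h with h0 | h0
    · have : ∀ x, G x - G (x + h) ≤ 0 := fun x => sub_nonpos.2 (hG (by linarith))
      rw [abs_of_nonpos (integral_nonpos this), ← integral_neg]
      exact integral_congr_ae (Filter.Eventually.of_forall fun x => abs_of_nonpos (this x))
    · have : ∀ x, 0 ≤ G x - G (x + h) := fun x => sub_nonneg.2 (hG (by linarith))
      rw [abs_of_nonneg (integral_nonneg this)]
      exact integral_congr_ae (Filter.Eventually.of_forall fun x => abs_of_nonneg (this x))
  -- The integrals over I and its translate cancel on the overlap, leaving two end pieces of length
  -- |h|. All points involved lie in [-3, 3].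
  have e2 : ∫ x in unitI, (G x - G (x + h)) = ∫ t in (0 : ℝ)..h, (G (t + -1) - G (t + 1)) := by
    have hs : ∀ c : ℝ, IntervalIntegrable (fun x => G (x + c)) volume 0 h := fun c =>
      (hG.comp fun x y hxy => by simpa using hxy : Monotone fun x => G (x + c)).intervalIntegrable
    rw [← integral_Ioc_eq_integral_Ioo, ← intervalIntegral.integral_of_le (by norm_num),
      intervalIntegral.integral_sub (hi _ _) hi', intervalIntegral.integral_sub (hs _) (hs _),
      intervalIntegral.integral_comp_add_right, intervalIntegral.integral_comp_add_right,
      intervalIntegral.integral_comp_add_right,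
      intervalIntegral.integral_interval_sub_interval_comm (hi _ _) (hi _ _) (hi _ _)]
    simp only [zero_add, add_comm h]
  rw [e1, e2, ← Real.norm_eq_abs]
  refine (intervalIntegral.norm_integral_le_of_norm_le_const (C := G 3 - G (-3))
    fun t ht => ?_).trans_eq (by rw [sub_zero])
  have htb : -2 ≤ t ∧ t ≤ 2 := by
    rw [mem_uIoc] at ht
    rcases ht with ht | ht <;> constructor <;> linarith [ht.1, ht.2, hh.1, hh.2]
  rw [Real.norm_eq_abs, abs_le]
  constructor <;> linarith [hG (show t + -1 ≤ t + 1 by linarith),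
    hG (show t + 1 ≤ 3 by linarith), hG (show -3 ≤ t + -1 by linarith)]

/-- Monotone functions belong to `H^σ` on bounded intervals for every `σ < 1 / 2`. -/
theorem Monotone.gagliardoSq_lt_top {G : ℝ → ℝ} (hG : Monotone G) {σ : ℝ} (hσ : σ < 1 / 2) :
    gagliardoSq σ G < ⊤ := by
  set B := G 3 - G (-3)
  have hB : 0 ≤ B := sub_nonneg.2 (hG (by norm_num))
  have hGm : Measurable G := hG.measurable
  have hbd : ∀ x ∈ unitI, ∀ y ∈ unitI, |G x - G y| ≤ B := by
    intro x hx y hy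
    rw [abs_le]
    constructor <;> linarith [hG (show x ≤ 3 by linarith [hx.2]), hG (show y ≤ 3 by linarith [hy.2]),
      hG (show -3 ≤ x by linarith [hx.1]), hG (show -3 ≤ y by linarith [hy.1])]
  -- Substitute y = x + h and bound one of the two factors |G x - G y| by B. The L¹ modulus of the
  -- other gains a power |h|, leaving |h|^(-2σ), which is integrable as 2σ < 1.
  have h1 : gagliardoSq σ G ≤ ∫⁻ x in unitI, ∫⁻ h in Ioo (-2 : ℝ) 2,
      ENNReal.ofReal (B / |h| ^ (1 + 2 * σ)) * ENNReal.ofReal |G x - G (x + h)| := by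
    refine setLIntegral_mono' measurableSet_Ioo fun x hx => ?_
    rw [← lintegral_indicator measurableSet_Ioo, ← lintegral_indicator measurableSet_Ioo,
      ← lintegral_add_left_eq_self _ x]
    refine lintegral_mono fun h => ?_
    by_cases hxh : x + h ∈ unitI
    · have hh : h ∈ Ioo (-2 : ℝ) 2 :=
        ⟨by linarith [hxh.1, hx.2], by linarith [hxh.2, hx.1]⟩
      rw [indicator_of_mem hxh, indicator_of_mem hh, ← ENNReal.ofReal_mul (by positivity)]
      refine ENNReal.ofReal_le_ofReal ?_
      rw [show |x - (x + h)| = |h| by rw [sub_add_cancel_left, abs_neg], div_mul_eq_mul_div]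
      gcongr
      rw [← sq_abs, sq]
      gcongr
      exact hbd x hx _ hxh
    · rw [indicator_of_notMem hxh]
      exact zero_le
  refine h1.trans_lt ?_
  rw [lintegral_lintegral_swap (by fun_prop)]
  have h2 : ∫⁻ h in Ioo (-2 : ℝ) 2, ∫⁻ x in unitI,
      ENNReal.ofReal (B / |h| ^ (1 + 2 * σ)) * ENNReal.ofReal |G x - G (x + h)|
      ≤ ∫⁻ h in Ioo (-2 : ℝ) 2, ENNReal.ofReal (B ^ 2 * |h| ^ (-(2 * σ))) := by
    refine setLIntegral_mono' measurableSet_Ioo fun h hh => ?_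
    rw [lintegral_const_mul' _ _ ENNReal.ofReal_ne_top]
    refine (mul_le_mul_right (Monotone.lintegral_abs_sub_le hG hh) _).trans ?_
    rw [← ENNReal.ofReal_mul (by positivity)]
    refine ENNReal.ofReal_le_ofReal ?_
    rcases eq_or_ne h 0 with rfl | h0
    · simp only [abs_zero, mul_zero]
      positivity
    · have hp : 0 < |h| := abs_pos.2 h0
      rw [Real.rpow_add hp, Real.rpow_one, Real.rpow_neg hp.le]
      have : 0 < |h| ^ (2 * σ) := by positivity
      apply le_of_eq
      field_simp
      rw [sq]
  refine h2.trans_lt ?_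
  have hint := ((intervalIntegrable_iff_integrableOn_Ioo_of_le (by norm_num)).1
    (intervalIntegrable_abs_rpow (r := -(2 * σ)) (by linarith))).const_mul (B ^ 2)
  exact hint.lintegral_lt_top

/-! ### Regularity of the optimal state. -/

/-- The admissible direction `ψ - ybar'` has positive mean value, which is Slater's condition. -/
theorem IsSolution.slater {β : ℝ} {yd f ψ ψ' ybar : ℝ → ℝ} (hybar : IsSolution β yd f ψ ybar)
    (hψ : HasL2Deriv ψ ψ') (hψpos : 0 < ∫ x in unitI, ψ x) :
    0 < ∫ x in unitI, (ψ x - weakDeriv 1 ybar x) := by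
  have hV := hybar.memK.memV
  have hp := hV.memH.hasL2Deriv (by norm_num)
  have hr := hV.memH.hasL2Deriv_weakDeriv le_rfl
  have hp0 := setIntegral_weakDeriv_eq_zero hp.hasWeakDeriv hr.memL2.integrableOn
    hV.continuousOn hV.left hV.right
  rw [integral_sub hψ.memL2.integrableOn hr.memL2.integrableOn, hp0, sub_zero]
  exact hψpos

theorem HasL2Deriv.sub {z k w l : ℝ → ℝ} (hz : HasL2Deriv z k) (hw : HasL2Deriv w l) :
    HasL2Deriv (fun x => z x - w x) (k + (-1 : ℝ) • l) := by
  have h := hz.add (hw.const_smul (-1))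
  rwa [show z + (-1 : ℝ) • w = fun x => z x - w x by ext x; simp [sub_eq_add_neg]] at h

/-- The function `β (ybar'' + f)` is the sum of a monotone and a linear function. -/
theorem IsSolution.exists_monotone {β : ℝ} {yd f ψ ψ' ybar : ℝ → ℝ}
    (hybar : IsSolution β yd f ψ ybar) (hyd : MemL2 yd) (hf : MemL2 f)
    (hψ : HasL2Deriv ψ ψ') (hψpos : 0 < ∫ x in unitI, ψ x) :
    ∃ M : ℝ, 0 ≤ M ∧ ∃ G : ℝ → ℝ, Monotone G ∧
      (fun x => β * (weakDeriv 2 ybar x + f x)) =ᵐ[volume.restrict unitI]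
        fun x => G x - M * x := by
  have hV := hybar.memK.memV
  have hr := hV.memH.hasL2Deriv_weakDeriv le_rfl
  have hD : MemL2 (fun x => ybar x - yd x) := MemLp.sub hV.memH.memL2_self hyd
  have hF : MemL2 (fun x => β * (weakDeriv 2 ybar x + f x)) := by
    have h : MemL2 (weakDeriv 2 ybar + f) := MemLp.add hr.memL2_deriv hf
    exact MemLp.const_smul h β
  have hg0 : ∀ᵐ x ∂(volume.restrict unitI), 0 ≤ ψ x - weakDeriv 1 ybar x :=
    hybar.memK.deriv_le.mono fun x hx => sub_nonneg.2 hx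
  obtain ⟨M, hM, H⟩ := exists_bound_of_costDeriv_nonneg hD hF (hψ.sub hr) hg0
    (hybar.slater hψ hψpos) fun z k hz hle h0 => hybar.costDeriv_nonneg hz hle h0
  exact ⟨M, hM, exists_monotone_of_bound hF hM H⟩

/-- Higher regularity of the optimal state. -/
theorem IsSolution.memH {β : ℝ} (hβ : 0 < β) {yd f ψ ybar : ℝ → ℝ} (hyd : MemL2 yd)
    (hf : ∀ ε ∈ Ioo (0 : ℝ) (1 / 2), MemH (1 / 2 - ε) f)
    (hψ : ∀ ε ∈ Ioo (0 : ℝ) (1 / 2), MemH (3 / 2 - ε) ψ)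
    (hψpos : 0 < ∫ x in unitI, ψ x) (hybar : IsSolution β yd f ψ ybar) :
    ∀ ε ∈ Ioo (0 : ℝ) (1 / 2), MemH (5 / 2 - ε) ybar := by
  intro ε hε
  obtain ⟨hε0, hε1⟩ := hε
  have hV := hybar.memK.memV
  have hfε := hf ε ⟨hε0, hε1⟩
  have hψ1 := (hψ ε ⟨hε0, hε1⟩).hasL2Deriv (by linarith)
  obtain ⟨M, hM, G, hG, hFG⟩ := hybar.exists_monotone hyd hfε.memL2_self hψ1 hψpos
  -- As 0 < ε < 1/2, the order 5/2 - ε has integer part 2: membership in H² is already part of V,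
  -- and only the seminorm of ȳ'' of order 1/2 - ε remains.
  have hfl : ⌊5 / 2 - ε⌋₊ = 2 := by
    rw [Nat.floor_eq_iff (by linarith)]
    constructor <;> norm_num <;> linarith
  have hfr : Int.fract (5 / 2 - ε) = 1 / 2 - ε := by
    rw [Int.fract_eq_iff]
    exact ⟨by linarith, by linarith, 2, by push_cast; ring⟩
  have hffl : ⌊1 / 2 - ε⌋₊ = 0 := Nat.floor_eq_zero.2 (by linarith)
  have hffr : Int.fract (1 / 2 - ε) = 1 / 2 - ε :=
    Int.fract_eq_self.2 ⟨by linarith, by linarith⟩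
  have h2fl : ⌊(2 : ℝ)⌋₊ = 2 := by norm_num
  refine ⟨by linarith, fun k hk => hV.memH.hasWeakDeriv k (by rwa [h2fl, ← hfl]),
    fun k hk => hV.memH.memL2 k (by rwa [h2fl, ← hfl]), fun _ => ?_⟩
  have hfG : gagliardoSq (1 / 2 - ε) f < ⊤ := by
    have h1 := hfε.gagliardo (by rw [hffr]; linarith)
    rw [hffl, hffr] at h1
    rwa [gagliardoSq_congr (HasWeakDeriv.zero_order
      (hfε.hasWeakDeriv 0 (Nat.zero_le _)).locallyIntegrable).weakDeriv_ae] at h1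
  have hGG := Monotone.gagliardoSq_lt_top hG (σ := 1 / 2 - ε) (by linarith)
  -- The linear term is itself monotone because M ≥ 0.
  have hlin := Monotone.gagliardoSq_lt_top (G := fun x => M * x)
    (fun x y hxy => mul_le_mul_of_nonneg_left hxy hM) (σ := 1 / 2 - ε) (by linarith)
  have hGm : Measurable fun x => β⁻¹ * (G x - M * x) :=
    (hG.measurable.sub (measurable_id.const_mul M)).const_mul _
  have hGL : gagliardoSq (1 / 2 - ε) (fun x => β⁻¹ * (G x - M * x)) < ⊤ := by
    rw [gagliardoSq_const_mul]
    exact ENNReal.mul_lt_top ENNReal.ofReal_lt_top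
      (gagliardoSq_sub_lt_top hG.measurable hGG hlin)
  rw [hfl, hfr, gagliardoSq_congr (h := fun x => β⁻¹ * (G x - M * x) - f x)]
  · exact gagliardoSq_sub_lt_top hGm hGL hfG
  · filter_upwards [hFG] with x hx
    rw [← hx, inv_mul_cancel_left₀ hβ.ne', add_sub_cancel_right]

end DerivativeConstrained

end

theorem theorem2p3 (β : ℝ) (hβ : 0 < β) (yd f ψ : ℝ → ℝ)
    (hyd : DerivativeConstrained.MemL2 yd)
    (hf : ∀ ε ∈ Set.Ioo (0 : ℝ) (1 / 2), DerivativeConstrained.MemH (1 / 2 - ε) f)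
    (hψ : ∀ ε ∈ Set.Ioo (0 : ℝ) (1 / 2), DerivativeConstrained.MemH (3 / 2 - ε) ψ)
    (hψpos : 0 < ∫ x in Set.Ioo (-1 : ℝ) 1, ψ x)
    (ybar : ℝ → ℝ) (hybar : DerivativeConstrained.IsSolution β yd f ψ ybar) :
    ∀ ε ∈ Set.Ioo (0 : ℝ) (1 / 2), DerivativeConstrained.MemH (5 / 2 - ε) ybar := by
  exact hybar.memH hβ hyd hf hψ hψpos
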